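/- Let $\mathcal R_g(1^{2g})$ be the moduli space of pairs $(X,\psi)$, where $X$ is a compact connected Riemann surface of genus $g$ and $\psi$ is a meromorphic differential on $X$ with a single pole, of order two, with only simple zeros and with all periods real. \textbf{Arc diagrams.} An arc diagram is a set of $2n$ distinct points of the real line split into $n$ pairs (arcs); the length of an arc is the distance between its ends. Suppose that no two zeros of $\psi$ are joined by a vertical trajectory. Cut $X$ along all vertical trajectories ($\operatorname{Re}\int\psi=\mathrm{const}$, oriented by the growth of $\operatorname{Im}\int\psi$) entering the zeros, two for each zero. The map $q\mapsto\int_Z^q\psi$ identifies the result with the plane $\mathbb C$ cut along $4g$ downward vertical rays; the two rays that start at the two images of one zero form a pair and start at the same height. The real parts of the $4g$ rays, split into pairs, form the arc diagram $\mathcal D_\psi$ (with $2g$ arcs), defined up to translation. \textbf{Transformations.} A \emph{shift} translates one arc without changing the order of the ends of all the arcs. A \emph{Vassiliev move} of an arc $O_i$ along an arc $O_j$, $i\ne j$, changes only $O_i$, as follows. Let $p$ be an end of $O_i$ adjacent to an end $a$ of $O_j$ (no end of an arc lies between them), and let $q$, $b$ be the other ends of $O_i$, $O_j$. The new arc has ends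 $p',q'$ with $p'-q'=(p-q)+(b-a)$; the end $q'$ has the same position as $q$ with respect to the ends of the other arcs; the end $p'$ is adjacent to $b$, on the right of $b$ if $p<a$ and on the left of $b$ if $p>a$. \textbf{Caravans.} Two arcs intersect if exactly one end of one of them lies between the ends of the other. A \emph{$g$-caravan} is an arc diagram that consists of $g$ pairs of intersecting arcs, such that arcs of different pairs do not intersect and no pair lies on the interval bounded by the ends of a third arc. Its \emph{period vector} is the column of the $2g$ lengths of its arcs, listed in the order of their left ends from left to right. \textbf{Proposition.} Let two points of $\mathcal R_g(1^{2g})$ have arc diagrams $\mathcal D_1$, $\mathcal D_2$ that are $g$-caravans with period vectors $P_1$, $P_2$. If $\mathcal D_2$ is obtained from $\mathcal D_1$ by a finite sequence of shifts and Vassiliev moves, then there is a matrix $M\in Sp_{2g}(\mathbb Z)$ such that $P_1=MP_2$. Here $Sp_{2g}(\mathbb Z)$ is the group of integer $2g\times 2g$ matrices $M$ with $MJM^{T}=J$, where $J$ is block diagonal with $g$ blocks $\begin{pmatrix}0&1\\-1&0\end{pmatrix}$. -/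

import Mathlib

open scoped Manifold ContDiff Topology

universe u v

/-! ### Real-normalized differentials -/

/-- Complex-linear 1-forms on a Riemann surface, as (not necessarily continuous) fields of
cotangent vectors. -/
abbrev OneForm (X : Type u) [TopologicalSpace X] [ChartedSpace ℂ X] : Type u :=
  ∀ x : X, TangentSpace 𝓘(ℂ) x →L[ℂ] ℂ

namespace OneForm

variable {X : Type u} [TopologicalSpace X] [ChartedSpace ℂ X]

/-- The value of a 1-form on a tangent vector given in the preferred coordinate at `x`. -/
noncomputable def eval (ψ : OneForm X) (x : X) (v : ℂ) : ℂ := ψ x v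

/-- The coefficient `f` in the expression `ψ = f(w) dw` in the preferred chart `w` at `x`. -/
noncomputable def coeff (ψ : OneForm X) (x : X) (w : ℂ) : ℂ :=
  ψ.eval ((chartAt ℂ x).symm w) (mfderiv 𝓘(ℂ) 𝓘(ℂ) (chartAt ℂ x).symm w (1 : ℂ))

/-- `ψ` is holomorphic at `x`. -/
def HolomorphicAt (ψ : OneForm X) (x : X) : Prop :=
  AnalyticAt ℂ (ψ.coeff x) (chartAt ℂ x x)

/-- The value of `ψ` on the velocity vector of the path `γ` at time `t`. -/
noncomputable def alongPath (ψ : OneForm X) (γ : ℝ → X) (t : ℝ) : ℂ :=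
  ψ.eval (γ t) (mfderiv 𝓘(ℝ) 𝓘(ℝ, ℂ) γ t (1 : ℝ))

/-- The zeros of a form outside the point `p` (which will be the pole of the form). -/
def zeros (ψ : OneForm X) (p : X) : Set X := {x | x ≠ p ∧ ψ x = 0}

/-- All periods of `ψ` (integrals over closed curves that avoid the pole `p`) are real. -/
def RealPeriods (ψ : OneForm X) (p : X) : Prop :=
  ∀ γ : ℝ → X, ContMDiff 𝓘(ℝ) 𝓘(ℝ, ℂ) 1 γ → γ 0 = γ 1 →
    (∀ t ∈ Set.Icc (0 : ℝ) 1, γ t ≠ p) →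
    (∫ t in (0 : ℝ)..1, ψ.alongPath γ t).im = 0

/-- The points `x` lying on a separatrix that enters a zero `q` of `ψ`: the vertical trajectory
from `x`, parametrized by the growth of the imaginary part of `∫ ψ`, reaches `q` in finite time. -/
def incomingSeparatrices (ψ : OneForm X) (p : X) : Set X :=
  {x | ∃ q ∈ ψ.zeros p, ∃ T : ℝ, 0 < T ∧ ∃ γ : ℝ → X,
    γ 0 = x ∧ ContinuousOn γ (Set.Ico 0 T) ∧
    (∀ t ∈ Set.Ioo 0 T, γ t ≠ p ∧ MDifferentiableAt 𝓘(ℝ) 𝓘(ℝ, ℂ) γ t ∧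
      ψ.alongPath γ t = Complex.I) ∧
    Filter.Tendsto γ (𝓝[<] T) (𝓝 q)}

/-- The graph of separatrices: its vertices are the zeros and the pole, its edges are all the
separatrices that enter the zeros. -/
def separatrixGraph (ψ : OneForm X) (p : X) : Set X :=
  {p} ∪ ψ.zeros p ∪ ψ.incomingSeparatrices p

end OneForm

/-- The genus of a compact Riemann surface: the dimension of the space of holomorphic 1-forms. -/
noncomputable def surfaceGenus (X : Type u) [TopologicalSpace X] [ChartedSpace ℂ X] : ℕ :=
  Module.finrank ℂ (Submodule.span ℂ {η : OneForm X | ∀ x, η.HolomorphicAt x})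

/-- A representative of a point of the moduli space `R_g(1^{2g})`: a compact connected Riemann
surface of genus `g` with a real-normalized meromorphic differential that has a single pole, the
pole is of order two, and all the zeros are simple. (The value that `form` takes at `pole` itself
carries no information. The number of zeros is then `2g`, because the degree of the divisor of
`form` is `2g - 2`.) -/
structure SimpleRealNormalizedDifferential (g : ℕ) : Type (u + 1) where
  carrier : Type u
  [topology : TopologicalSpace carrier]
  [hausdorff : T2Space carrier]
  [compact : CompactSpace carrier]
  [connected : ConnectedSpace carrier]
  [charts : ChartedSpace ℂ carrier]
  [complexAnalytic : IsManifold 𝓘(ℂ) ω carrier]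
  genus_eq : surfaceGenus carrier = g
  pole : carrier
  form : OneForm carrier
  holomorphicAt : ∀ x, x ≠ pole → form.HolomorphicAt x
  order_pole : meromorphicOrderAt (form.coeff pole) (chartAt ℂ pole pole) = -2
  simple_zeros : ∀ x ∈ form.zeros pole, analyticOrderAt (form.coeff x) (chartAt ℂ x x) = 1
  realPeriods : form.RealPeriods pole

attribute [instance] SimpleRealNormalizedDifferential.topology
  SimpleRealNormalizedDifferential.hausdorff SimpleRealNormalizedDifferential.compact
  SimpleRealNormalizedDifferential.connected SimpleRealNormalizedDifferential.charts
  SimpleRealNormalizedDifferential.complexAnalytic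

/-! ### Arc diagrams -/

/-- An arc diagram with `n` numbered arcs: `2n` distinct points of the line split into `n` pairs.
The arc number `i` joins the point `pt (i, false)` to the point `pt (i, true)` on its right. -/
@[ext]
structure ArcDiagram (n : ℕ) where
  pt : Fin n × Bool → ℝ
  injective : Function.Injective pt
  left_lt_right : ∀ i, pt (i, false) < pt (i, true)

namespace ArcDiagram

variable {n : ℕ}

/-- The left end of an arc. -/
def left (D : ArcDiagram n) (i : Fin n) : ℝ := D.pt (i, false)

/-- The right end of an arc. -/
def right (D : ArcDiagram n) (i : Fin n) : ℝ := D.pt (i, true)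

/-- The length of an arc. -/
def length (D : ArcDiagram n) (i : Fin n) : ℝ := D.right i - D.left i

/-- The same arc diagram with another numbering of the arcs. -/
def renumber (D : ArcDiagram n) (σ : Equiv.Perm (Fin n)) : ArcDiagram n where
  pt x := D.pt (σ x.1, x.2)
  injective := by
    rintro ⟨i, s⟩ ⟨j, t⟩ h
    have h' := D.injective h
    simp only [Prod.mk.injEq, EmbeddingLike.apply_eq_iff_eq] at h'
    exact Prod.ext h'.1 h'.2
  left_lt_right i := D.left_lt_right (σ i)

/-- The lengths of the arcs, listed in the order of the left ends of the arcs from left to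
right. -/
noncomputable def periodVector (D : ArcDiagram n) (k : Fin n) : ℝ :=
  D.length (Tuple.sort D.left k)

/-- Two arcs intersect: exactly one end of one of them lies between the ends of the other. -/
def Crosses (D : ArcDiagram n) (i j : Fin n) : Prop :=
  (D.left i < D.left j ∧ D.left j < D.right i ∧ D.right i < D.right j) ∨
  (D.left j < D.left i ∧ D.left i < D.right j ∧ D.right j < D.right i)

/-- The arc `i` lies on the interval bounded by the ends of the arc `j`. -/
def Inside (D : ArcDiagram n) (i j : Fin n) : Prop :=
  D.left j < D.left i ∧ D.right i < D.right j

/-- `D` is a `g`-caravan: its arcs split into `g` pairs of intersecting arcs, arcs of different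
pairs do not intersect, and no pair lies on the interval bounded by the ends of a third arc. -/
def IsCaravan {g : ℕ} (D : ArcDiagram (2 * g)) : Prop :=
  ∃ e : Fin g × Bool ≃ Fin (2 * g),
    (∀ k, D.Crosses (e (k, false)) (e (k, true))) ∧
    (∀ k l, k ≠ l → ∀ s t, ¬ D.Crosses (e (k, s)) (e (l, t))) ∧
    (∀ k l, k ≠ l → ∀ t, ¬ (D.Inside (e (k, false)) (e (l, t)) ∧
      D.Inside (e (k, true)) (e (l, t))))

/-- A shift: one arc is translated and the order of the ends of all the arcs is preserved. -/
def IsShift (D D' : ArcDiagram n) : Prop :=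
  ∃ (i : Fin n) (ε : ℝ),
    (∀ s, D'.pt (i, s) = D.pt (i, s) + ε) ∧
    (∀ k, k ≠ i → ∀ s, D'.pt (k, s) = D.pt (k, s)) ∧
    (∀ x y, D'.pt x < D'.pt y ↔ D.pt x < D.pt y)

/-- No end of an arc of `D` lies strictly between `x` and `y`. -/
def Adjacent (D : ArcDiagram n) (x y : ℝ) : Prop := ∀ z, ¬ (x < D.pt z ∧ D.pt z < y)

/-- The (second) Vassiliev move of the arc `i` along the arc `j`. The end `p = pt (i, s)` is
adjacent to the end `a = pt (j, t)`; let `b = pt (j, !t)` be the other end of the arc `j` and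
`q = pt (i, !s)` the other end of the arc `i`. The end `p` is dragged along the arc `j` and becomes
an end `p'` adjacent to `b`: if it was on the left of `a`, it comes out on the right of `b`, and
vice versa. The oriented length `p - q` of the arc `i` increases by the oriented length `b - a` of
the arc `j`, the end `q` becomes an end `q'` with the same place in the order of the ends, and the
other arcs do not change. The arc keeps its number; which of its ends is the left one may change
(whence `s'`). -/
def IsVassilievMove (D D' : ArcDiagram n) : Prop :=
  ∃ (i j : Fin n) (s s' t : Bool), i ≠ j ∧
    (∀ k, k ≠ i → ∀ r, D'.pt (k, r) = D.pt (k, r)) ∧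
    D'.pt (i, s') - D'.pt (i, !s') =
      (D.pt (i, s) - D.pt (i, !s)) + (D.pt (j, !t) - D.pt (j, t)) ∧
    (∀ k, k ≠ i → ∀ r, D'.pt (i, !s') < D'.pt (k, r) ↔ D.pt (i, !s) < D.pt (k, r)) ∧
    ((D.pt (i, s) < D.pt (j, t) ∧ D.Adjacent (D.pt (i, s)) (D.pt (j, t)) ∧
        D'.pt (j, !t) < D'.pt (i, s') ∧ D'.Adjacent (D'.pt (j, !t)) (D'.pt (i, s'))) ∨
      (D.pt (j, t) < D.pt (i, s) ∧ D.Adjacent (D.pt (j, t)) (D.pt (i, s)) ∧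
        D'.pt (i, s') < D'.pt (j, !t) ∧ D'.Adjacent (D'.pt (i, s')) (D'.pt (j, !t))))

/-- The arc diagram `D'` is obtained from `D`, up to the numbering of the arcs, by a finite
sequence of shifts and Vassiliev moves. -/
def ObtainedFrom (D' D : ArcDiagram n) : Prop :=
  ∃ σ : Equiv.Perm (Fin n),
    Relation.ReflTransGen (fun A B : ArcDiagram n => A.IsShift B ∨ A.IsVassilievMove B)
      D (D'.renumber σ)

/-- The tip of the vertical slit that ends over the point `pt x`, when `h i` is the height of the
zero number `i`. -/
def tip (D : ArcDiagram n) (h : Fin n → ℝ) (x : Fin n × Bool) : ℂ := ⟨D.pt x, h x.1⟩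

/-- The plane cut along the closed vertical rays that go down from the tips. -/
def slitPlane (D : ArcDiagram n) (h : Fin n → ℝ) : Set ℂ :=
  {z | ∀ x : Fin n × Bool, ¬ (z.re = (D.tip h x).re ∧ z.im ≤ (D.tip h x).im)}

end ArcDiagram

/-- `D` is the arc diagram of the differential `x = (X, ψ)`. There are heights `h i`, a numbering
`Q` of the zeros of `ψ`, and a biholomorphic map `Φ` from the plane cut along vertical rays onto
the complement of the graph of separatrices, with `Φ^* ψ = dz`, so that `Φ` is inverse to the map
`q ↦ ∫_Z^q ψ`; the two slits over the ends of the arc `i` start at the two images of the zero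
`Q i`. As the ends of the arcs of `D` are distinct, such a diagram exists only if no two zeros are
joined by a separatrix; it is then unique up to a translation and the numbering of the arcs. -/
def SimpleRealNormalizedDifferential.HasArcDiagram {g : ℕ}
    (x : SimpleRealNormalizedDifferential.{u} g) (D : ArcDiagram (2 * g)) : Prop :=
  ∃ (h : Fin (2 * g) → ℝ) (Q : Fin (2 * g) → x.carrier) (Φ : ℂ → x.carrier),
    Function.Injective Q ∧ Set.range Q = x.form.zeros x.pole ∧
    MDifferentiableOn 𝓘(ℂ) 𝓘(ℂ) Φ (D.slitPlane h) ∧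
    Set.InjOn Φ (D.slitPlane h) ∧
    Φ '' D.slitPlane h = (x.form.separatrixGraph x.pole)ᶜ ∧
    (∀ z ∈ D.slitPlane h, x.form.eval (Φ z) (mfderiv 𝓘(ℂ) 𝓘(ℂ) Φ z (1 : ℂ)) = 1) ∧
    (∀ e : Fin (2 * g) × Bool,
      Filter.Tendsto Φ (𝓝[D.slitPlane h] (D.tip h e)) (𝓝 (Q e.1)))

/-! ### The group `Sp_{2g}(ℤ)` -/

/-- The numbering of the coordinates of `ℤ^{2g}` in which the symplectic form consists of `g`
consecutive blocks of size two: the `k`-th pair of dual coordinates is `2k`, `2k + 1`. -/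
def pairIndex (g : ℕ) : Fin g ⊕ Fin g ≃ Fin (2 * g) where
  toFun
    | Sum.inl k => ⟨2 * k, by omega⟩
    | Sum.inr k => ⟨2 * k + 1, by omega⟩
  invFun m := if (m : ℕ) % 2 = 0 then Sum.inl ⟨m / 2, by omega⟩ else Sum.inr ⟨m / 2, by omega⟩
  left_inv := by
    rintro (k | k) <;> dsimp only <;> split_ifs with h
    · exact congrArg Sum.inl (Fin.ext (by dsimp only; omega))
    · exact absurd (by omega) h
    · exact absurd h (by omega)
    · exact congrArg Sum.inr (Fin.ext (by dsimp only; omega))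
  right_inv m := by
    dsimp only
    split_ifs with h <;> exact Fin.ext (by dsimp only; omega)

/-- `Sp_{2g}(ℤ)`: the integer matrices of size `2g` that preserve the symplectic form whose matrix
is block diagonal with `g` blocks `(0 1; -1 0)` (the intersection matrix of a `g`-caravan). -/
def integerSymplecticGroup (g : ℕ) : Set (Matrix (Fin (2 * g)) (Fin (2 * g)) ℤ) :=
  {M | M.submatrix (pairIndex g) (pairIndex g) ∈ Matrix.symplecticGroup (Fin g) ℤ}

/-!
Orient every arc from left to right and let `Ω_D` be the skew-symmetric integer matrix of signed
intersection numbers of the arcs of `D`. It is computed by counting ends: the number of the arc `i`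
with the arc `k` is the difference of the values at the two ends of `i` of the indicator function
of the interval bounded by `k` (`ArcDiagram.intersectionMatrix`).

Shifts change neither the lengths nor `Ω_D`. A Vassiliev move of the arc `i` along the arc `j`
replaces the oriented arc `i` by the sum of the oriented arcs `i` and `j`, up to signs: this is the
definition for the lengths, and for the intersection numbers it holds because the end that moves is
adjacent to one end of `j` before the move and to the other one after it. Hence there is an integer
matrix `A` that takes the lengths to the new lengths and satisfies `Ω_{D'} = A Ω_D Aᵀ`
(`IsIntegralChange.of_isVassilievMove`), and such matrices multiply along a sequence of moves.

In a caravan the two crossing arcs of each pair are consecutive in the order of the left ends,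
because different pairs occupy disjoint intervals. So in this order `Ω_D` is the standard block
diagonal symplectic matrix (`IsCaravan.intersectionMatrix_sort`). An integer matrix that relates
two caravans is therefore symplectic, and its inverse is the required matrix.
-/

open Matrix

namespace ArcDiagram

variable {n : ℕ}

/-! ### Intersection numbers of arcs -/

/-- The indicator function of the open interval bounded by the ends of the arc `k`. -/
noncomputable def indicator (D : ArcDiagram n) (k : Fin n) (x : ℝ) : ℤ :=
  open Classical in if D.pt (k, false) < x ∧ x < D.pt (k, true) then 1 else 0

/-- The matrix of signed intersection numbers of the arcs, oriented from left to right: the entry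
`(i, k)` is `1` if `i` and `k` intersect and `i` begins first, `-1` if they intersect and `k`
begins first, and `0` otherwise. -/
noncomputable def intersectionMatrix (D : ArcDiagram n) : Matrix (Fin n) (Fin n) ℤ :=
  fun i k => D.indicator k (D.pt (i, true)) - D.indicator k (D.pt (i, false))

lemma indicator_pt_self (D : ArcDiagram n) (k : Fin n) (s : Bool) :
    D.indicator k (D.pt (k, s)) = 0 := by
  cases s <;> simp [indicator]

lemma intersectionMatrix_self (D : ArcDiagram n) (k : Fin n) : D.intersectionMatrix k k = 0 := by
  simp [intersectionMatrix, indicator_pt_self]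

lemma pt_ne_pt (D : ArcDiagram n) {i k : Fin n} (h : i ≠ k) (s t : Bool) :
    D.pt (i, s) ≠ D.pt (k, t) :=
  fun H => h (congrArg Prod.fst (D.injective H))

lemma intersectionMatrix_skew (D : ArcDiagram n) (i k : Fin n) :
    D.intersectionMatrix i k = -D.intersectionMatrix k i := by
  rcases eq_or_ne i k with rfl | h
  · simp [intersectionMatrix_self]
  · have h1 := D.left_lt_right i
    have h2 := D.left_lt_right k
    have h3 := D.pt_ne_pt h false false
    have h4 := D.pt_ne_pt h false true
    have h5 := D.pt_ne_pt h true false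
    have h6 := D.pt_ne_pt h true true
    simp only [intersectionMatrix, indicator]
    rcases h3.lt_or_gt with h3 | h3 <;> rcases h4.lt_or_gt with h4 | h4 <;>
      rcases h5.lt_or_gt with h5 | h5 <;> rcases h6.lt_or_gt with h6 | h6 <;>
      first
      | (exfalso; linarith)
      | simp [h3, h4, h5, h6, h3.not_gt, h4.not_gt, h5.not_gt, h6.not_gt]

lemma intersectionMatrix_eq_one (D : ArcDiagram n) {i k : Fin n}
    (h1 : D.left i < D.left k) (h2 : D.left k < D.right i) (h3 : D.right i < D.right k) :
    D.intersectionMatrix i k = 1 := by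
  simp only [intersectionMatrix, indicator, left, right] at *
  grind

lemma intersectionMatrix_eq_zero (D : ArcDiagram n) {i k : Fin n} (h : D.right i < D.left k) :
    D.intersectionMatrix i k = 0 := by
  have := D.left_lt_right i
  simp only [intersectionMatrix, indicator, left, right] at *
  grind

/-- The sign with which an end of an arc enters the oriented length. -/
def endSign (s : Bool) : ℤ := if s then 1 else -1

lemma endSign_mul_self (s : Bool) : endSign s * endSign s = 1 := by cases s <;> rfl

lemma pt_sub_pt (D : ArcDiagram n) (i : Fin n) (s : Bool) :
    D.pt (i, s) - D.pt (i, !s) = endSign s * D.length i := by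
  cases s <;> simp [endSign, length, left, right]

lemma indicator_sub_indicator (D : ArcDiagram n) (i k : Fin n) (s : Bool) :
    D.indicator k (D.pt (i, s)) - D.indicator k (D.pt (i, !s)) =
      endSign s * D.intersectionMatrix i k := by
  cases s <;> simp [endSign, intersectionMatrix]

lemma indicator_eq_of_adjacent (D : ArcDiagram n) {k : Fin n} {x y : ℝ} (hxy : x < y)
    (h : D.Adjacent x y) (hx : ∀ s, x ≠ D.pt (k, s)) (hy : ∀ s, y ≠ D.pt (k, s)) :
    D.indicator k x = D.indicator k y := by
  have h1 := h (k, false)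
  have h2 := h (k, true)
  have := hx false
  have := hx true
  have := hy false
  have := hy true
  simp only [indicator]
  grind

/-! ### The action of the moves on lengths and intersection numbers -/

/-- The lengths of the arcs and their intersection numbers in `D'` are obtained from those in `D`
by one integer change of the system of arcs. The matrix of the change is not required to be
invertible: for two caravans this follows from its compatibility with the intersection numbers. -/
def IsIntegralChange (D D' : ArcDiagram n) : Prop :=
  ∃ A : Matrix (Fin n) (Fin n) ℤ, D'.length = (A.map (Int.cast : ℤ → ℝ)) *ᵥ D.length ∧
    D'.intersectionMatrix = A * D.intersectionMatrix * Aᵀ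

lemma IsIntegralChange.refl (D : ArcDiagram n) : IsIntegralChange D D :=
  ⟨1, by simp, by simp⟩

lemma IsIntegralChange.trans {D D' D'' : ArcDiagram n} (h : IsIntegralChange D D')
    (h' : IsIntegralChange D' D'') : IsIntegralChange D D'' := by
  obtain ⟨A, hA, hA'⟩ := h
  obtain ⟨B, hB, hB'⟩ := h'
  refine ⟨B * A, ?_, ?_⟩
  · rw [hB, hA, mulVec_mulVec]
    exact congrArg (· *ᵥ D.length) (Matrix.map_mul (f := Int.castRingHom ℝ)).symm
  · rw [hB', hA', transpose_mul]
    simp only [Matrix.mul_assoc]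

lemma IsIntegralChange.of_isShift {D D' : ArcDiagram n} (h : D.IsShift D') :
    IsIntegralChange D D' := by
  obtain ⟨i, ε, hi, hk, hlt⟩ := h
  refine ⟨1, ?_, ?_⟩
  · ext k
    simp only [Int.cast_zero, Int.cast_one, Matrix.map_one, one_mulVec, length, left, right]
    by_cases hki : k = i
    · subst hki
      rw [hi, hi]
      ring
    · rw [hk k hki, hk k hki]
  · ext k l
    simp [intersectionMatrix, indicator, hlt]

/-- A matrix that differs from the identity only in the row `i` acts on skew-symmetric matrices by
changing the row and the column `i`. The diagonal entry `(i, i)` needs no condition, because it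
vanishes for both matrices. -/
lemma eq_updateRow_mul_mul_transpose {Ω Ω' : Matrix (Fin n) (Fin n) ℤ} {i j : Fin n} {c d : ℤ}
    (hΩ : ∀ k l, Ω k l = -Ω l k) (hΩ' : ∀ k l, Ω' k l = -Ω' l k)
    (h : ∀ k l, k ≠ i → l ≠ i → Ω' k l = Ω k l)
    (hi : ∀ l, l ≠ i → Ω' i l = c * Ω i l + d * Ω j l) :
    Ω' = (1 : Matrix (Fin n) (Fin n) ℤ).updateRow i (Pi.single i c + Pi.single j d) * Ω *
      ((1 : Matrix (Fin n) (Fin n) ℤ).updateRow i (Pi.single i c + Pi.single j d))ᵀ := by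
  have hv : ∀ w : Fin n → ℤ, (Pi.single i c + Pi.single j d) ⬝ᵥ w = c * w i + d * w j := by
    intro w
    rw [add_dotProduct, single_dotProduct, single_dotProduct]
  have hrow : ∀ (B : Matrix (Fin n) (Fin n) ℤ) (k l : Fin n),
      ((1 : Matrix (Fin n) (Fin n) ℤ).updateRow i (Pi.single i c + Pi.single j d) * B) k l =
        if k = i then c * B i l + d * B j l else B k l := by
    intro B k l
    rw [mul_apply']
    split_ifs with hk
    · subst hk
      rw [updateRow_self, hv]
    · rw [updateRow_ne hk]
      exact congrFun (one_mulVec fun m => B m l) k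
  have hcol : ∀ (B : Matrix (Fin n) (Fin n) ℤ) (k l : Fin n),
      (B * ((1 : Matrix (Fin n) (Fin n) ℤ).updateRow i (Pi.single i c + Pi.single j d))ᵀ) k l =
        if l = i then c * B k i + d * B k j else B k l := by
    intro B k l
    rw [← transpose_apply (_ * _), transpose_mul, transpose_transpose, hrow]
    rfl
  ext k l
  rw [hcol, hrow, hrow, hrow]
  by_cases hk : k = i <;> by_cases hl : l = i
  · subst hk hl
    have h1 := hΩ' l l
    have h2 := hΩ l l
    have h3 := hΩ j j
    have h4 := hΩ j l
    simp only [if_true]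
    rw [h4]
    have h1' : Ω' l l = 0 := by omega
    have h2' : Ω l l = 0 := by omega
    have h3' : Ω j j = 0 := by omega
    rw [h1', h2', h3']
    ring
  · subst hk
    simp [hl, hi l hl]
  · subst hl
    have h1 := hi k hk
    rw [hΩ' k l, h1, hΩ l k, hΩ j k]
    simp only [hk, if_false, if_true]
    ring
  · simp [hk, hl, h k l hk hl]

/-- With `p`, `q`, `a`, `b` the ends that take part in the move, the oriented arc from `q'` to `p'`
has the intersection numbers of the arc from `q` to `p` plus those of the arc from `a` to `b`. -/
lemma IsIntegralChange.of_isVassilievMove {D D' : ArcDiagram n} (h : D.IsVassilievMove D') :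
    IsIntegralChange D D' := by
  obtain ⟨i, j, s, s', t, hij, hk, hlen, hq, hadj⟩ := h
  have hind : ∀ l, l ≠ i → D'.indicator l = D.indicator l := by
    intro l hl
    funext x
    simp only [indicator, hk l hl]
  have hqind : ∀ l, l ≠ i →
      D'.indicator l (D'.pt (i, !s')) = D.indicator l (D.pt (i, !s)) := by
    intro l hl
    have h1 := hq l hl false
    have h2 := hq l hl true
    have h3 := D.pt_ne_pt hl false (!s)
    have h4 := D'.pt_ne_pt hl false (!s')
    simp only [indicator, hk l hl] at *
    grind
  -- The two adjacency conditions at once, `p` to `a` and `p'` to `b`. For the arc `j` itself, both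
  -- `p` and `p'` are inside it or both are outside of it.
  have hpind : ∀ l, l ≠ i → D'.indicator l (D'.pt (i, s')) =
      D.indicator l (D.pt (i, s)) +
        (D.indicator l (D.pt (j, !t)) - D.indicator l (D.pt (j, t))) := by
    intro l hl
    by_cases hlj : l = j
    · subst hlj
      rw [indicator_pt_self, indicator_pt_self, hind l hl]
      have h0 := D.left_lt_right l
      have h3 := D.pt_ne_pt hl false s
      have h4 := D.pt_ne_pt hl true s
      have h5 := D'.pt_ne_pt hl false s'
      have h6 := D'.pt_ne_pt hl true s'
      rcases hadj with ⟨h1, h2, h1', h2'⟩ | ⟨h1, h2, h1', h2'⟩ <;>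
      · have h7 := h2 (l, !t)
        have h8 := h2' (l, t)
        simp only [hk l hl] at *
        simp only [indicator]
        cases t <;> simp only [Bool.not_true, Bool.not_false] at * <;> grind
    · have key : D.indicator l (D.pt (i, s)) = D.indicator l (D.pt (j, t)) ∧
          D'.indicator l (D'.pt (i, s')) = D'.indicator l (D'.pt (j, !t)) := by
        have e1 := fun r => D.pt_ne_pt (Ne.symm hl) s r
        have e2 := fun r => D.pt_ne_pt (Ne.symm hlj) t r
        have e3 := fun r => D'.pt_ne_pt (Ne.symm hl) s' r
        have e4 := fun r => D'.pt_ne_pt (Ne.symm hlj) (!t) r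
        rcases hadj with ⟨h1, h2, h1', h2'⟩ | ⟨h1, h2, h1', h2'⟩
        · exact ⟨D.indicator_eq_of_adjacent h1 h2 e1 e2,
            (D'.indicator_eq_of_adjacent h1' h2' e4 e3).symm⟩
        · exact ⟨(D.indicator_eq_of_adjacent h1 h2 e2 e1).symm,
            D'.indicator_eq_of_adjacent h1' h2' e3 e4⟩
      rw [key.1, key.2, hind l hl, hk j hij.symm]
      ring
  have hs' := endSign_mul_self s'
  refine ⟨(1 : Matrix (Fin n) (Fin n) ℤ).updateRow i
    (Pi.single i (endSign s' * endSign s) + Pi.single j (endSign s' * endSign (!t))), ?_,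
    eq_updateRow_mul_mul_transpose D.intersectionMatrix_skew D'.intersectionMatrix_skew ?_ ?_⟩
  · ext k
    rw [mulVec]
    by_cases hki : k = i
    · subst hki
      have e : (fun m => ((1 : Matrix (Fin n) (Fin n) ℤ).updateRow k
          (Pi.single k (endSign s' * endSign s) + Pi.single j (endSign s' * endSign (!t)))).map
            (Int.cast : ℤ → ℝ) k m) =
          Pi.single k ((endSign s' * endSign s : ℤ) : ℝ) +
            Pi.single j ((endSign s' * endSign (!t) : ℤ) : ℝ) := by
        funext m
        simp [Pi.single_apply, apply_ite (Int.cast : ℤ → ℝ)]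
      rw [e, add_dotProduct, single_dotProduct, single_dotProduct]
      have h1 := D'.pt_sub_pt k s'
      have h2 := D.pt_sub_pt k s
      have h3 := D.pt_sub_pt j (!t)
      rw [Bool.not_not] at h3
      have hs : (endSign s' : ℝ) * endSign s' = 1 := by exact_mod_cast hs'
      rw [h1, h2, h3] at hlen
      push_cast
      linear_combination (endSign s' : ℝ) * hlen - D'.length k * hs
    · have e : (fun m => ((1 : Matrix (Fin n) (Fin n) ℤ).updateRow i
          (Pi.single i (endSign s' * endSign s) + Pi.single j (endSign s' * endSign (!t)))).map
            (Int.cast : ℤ → ℝ) k m) = Pi.single k 1 := by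
        funext m
        simp [updateRow_ne hki, one_apply, Pi.single_apply, eq_comm,
          apply_ite (Int.cast : ℤ → ℝ)]
      rw [e, single_dotProduct, one_mul]
      simp only [length, left, right, hk k hki]
  · intro k l hki hli
    simp only [intersectionMatrix, hind l hli, hk k hki]
  · intro l hli
    have h1 := D'.indicator_sub_indicator i l s'
    have h2 := D.indicator_sub_indicator i l s
    have h3 := D.indicator_sub_indicator j l (!t)
    rw [Bool.not_not] at h3
    rw [hpind l hli, hqind l hli] at h1
    linear_combination -D'.intersectionMatrix i l * hs' - endSign s' * h1 + endSign s' * h2 +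
      endSign s' * h3

lemma IsIntegralChange.of_reflTransGen {D D' : ArcDiagram n}
    (h : Relation.ReflTransGen (fun A B : ArcDiagram n => A.IsShift B ∨ A.IsVassilievMove B)
      D D') : IsIntegralChange D D' := by
  induction h with
  | refl => exact .refl D
  | tail _ h ih => exact ih.trans (h.elim .of_isShift .of_isVassilievMove)

/-! ### Caravans in standard order -/

lemma disjoint_or_inside_of_not_crosses (D : ArcDiagram n) {i k : Fin n} (h : i ≠ k)
    (hx : ¬ D.Crosses i k) :
    D.right i < D.left k ∨ D.right k < D.left i ∨ D.Inside i k ∨ D.Inside k i := by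
  have h1 := D.left_lt_right i
  have h2 := D.left_lt_right k
  have h3 := D.pt_ne_pt h false false
  have h4 := D.pt_ne_pt h false true
  have h5 := D.pt_ne_pt h true false
  have h6 := D.pt_ne_pt h true true
  simp only [Crosses, Inside, left, right] at *
  rcases h3.lt_or_gt with h3 | h3 <;> rcases h4.lt_or_gt with h4 | h4 <;>
    rcases h5.lt_or_gt with h5 | h5 <;> rcases h6.lt_or_gt with h6 | h6 <;>
    first
    | (exfalso; linarith)
    | simp_all

/-- The possible positions of a pair of intersecting arcs `c`, `d` with respect to an arc `a` that
they do not intersect, if the pair does not lie on the interval bounded by `a`. -/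
lemma pair_left_or_right_or_inside (D : ArcDiagram n) {a c d : Fin n}
    (hcd : D.left c < D.left d ∧ D.left d < D.right c ∧ D.right c < D.right d)
    (hac : a ≠ c) (had : a ≠ d) (xac : ¬ D.Crosses a c) (xad : ¬ D.Crosses a d)
    (ia : ¬ (D.Inside c a ∧ D.Inside d a)) :
    D.right d < D.left a ∨ D.right a < D.left c ∨ D.Inside a c ∨ D.Inside a d := by
  obtain ⟨q1, q2, q3⟩ := hcd
  have ha : D.left a < D.right a := D.left_lt_right a
  rcases D.disjoint_or_inside_of_not_crosses hac xac with h | h | h | h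
  · exact .inr (.inl h)
  · rcases D.disjoint_or_inside_of_not_crosses had xad with k | k | k | k
    · linarith
    · exact .inl k
    · exact .inr (.inr (.inr k))
    · linarith [k.1]
  · exact .inr (.inr (.inl h))
  · rcases D.disjoint_or_inside_of_not_crosses had xad with k | k | k | k
    · linarith [h.2]
    · linarith [h.1]
    · exact .inr (.inr (.inr k))
    · exact absurd ⟨h, k⟩ ia

/-- Two pairs of intersecting arcs as in a caravan occupy disjoint intervals. -/
lemma right_lt_left_or_right_lt_left (D : ArcDiagram n) {a b c d : Fin n}
    (hab : D.left a < D.left b ∧ D.left b < D.right a ∧ D.right a < D.right b)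
    (hcd : D.left c < D.left d ∧ D.left d < D.right c ∧ D.right c < D.right d)
    (hac : a ≠ c) (had : a ≠ d) (hbc : b ≠ c) (hbd : b ≠ d)
    (xac : ¬ D.Crosses a c) (xad : ¬ D.Crosses a d) (xbc : ¬ D.Crosses b c)
    (xbd : ¬ D.Crosses b d)
    (ic : ¬ (D.Inside a c ∧ D.Inside b c)) (id : ¬ (D.Inside a d ∧ D.Inside b d))
    (ia : ¬ (D.Inside c a ∧ D.Inside d a)) (ib : ¬ (D.Inside c b ∧ D.Inside d b)) :
    D.right b < D.left c ∨ D.right d < D.left a := by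
  have ha := D.pair_left_or_right_or_inside hcd hac had xac xad ia
  have hb := D.pair_left_or_right_or_inside hcd hbc hbd xbc xbd ib
  have hc := D.pair_left_or_right_or_inside hab hac.symm hbc.symm (mt Or.symm xac) (mt Or.symm xbc)
    ic
  have hd := D.pair_left_or_right_or_inside hab had.symm hbd.symm (mt Or.symm xad) (mt Or.symm xbd)
    id
  obtain ⟨p1, p2, p3⟩ := hab
  obtain ⟨q1, q2, q3⟩ := hcd
  rcases hc with h | h | ⟨h, h'⟩ | ⟨h, h'⟩
  · exact Or.inl h
  · rcases hd with k | k | ⟨k, k'⟩ | ⟨k, k'⟩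
    · linarith
    · exact Or.inr k
    · linarith
    · rcases hb with r | r | ⟨r, r'⟩ | ⟨r, r'⟩ <;> linarith
  · rcases ha with r | r | ⟨r, r'⟩ | ⟨r, r'⟩ <;> linarith
  · rcases hb with r | r | ⟨r, r'⟩ | ⟨r, r'⟩ <;> linarith

/-- The arcs of a caravan, grouped into pairs, with the pairs ordered from left to right and the
arc of a pair that begins first listed first. -/
lemma IsCaravan.exists_ordered_pairs {g : ℕ} {D : ArcDiagram (2 * g)} (hD : D.IsCaravan) :
    ∃ a b : Fin g → Fin (2 * g),
      (∀ k, D.left (a k) < D.left (b k) ∧ D.left (b k) < D.right (a k) ∧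
        D.right (a k) < D.right (b k)) ∧
      (∀ k l, k < l → D.right (b k) < D.left (a l)) := by
  obtain ⟨e, hcross, hdisj, hin⟩ := hD
  have hs : ∀ k, ∃ s, D.left (e (k, s)) < D.left (e (k, !s)) ∧
      D.left (e (k, !s)) < D.right (e (k, s)) ∧ D.right (e (k, s)) < D.right (e (k, !s)) := by
    intro k
    rcases hcross k with h | h
    · exact ⟨false, h⟩
    · exact ⟨true, h⟩
  choose s hs using hs
  have hsep : ∀ k l, k ≠ l → D.right (e (k, !s k)) < D.left (e (l, s l)) ∨
      D.right (e (l, !s l)) < D.left (e (k, s k)) := by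
    intro k l hkl
    have hne : ∀ r r', e (k, r) ≠ e (l, r') := fun r r' h =>
      hkl (congrArg Prod.fst (e.injective h))
    have hin' : ∀ k l, k ≠ l → ∀ r t, ¬ (D.Inside (e (k, r)) (e (l, t)) ∧
        D.Inside (e (k, !r)) (e (l, t))) := by
      intro k l h r t
      cases r
      · exact hin k l h t
      · exact fun H => hin k l h t H.symm
    exact D.right_lt_left_or_right_lt_left (hs k) (hs l) (hne _ _) (hne _ _) (hne _ _) (hne _ _)
      (hdisj k l hkl _ _) (hdisj k l hkl _ _) (hdisj k l hkl _ _) (hdisj k l hkl _ _)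
      (hin' k l hkl _ _) (hin' k l hkl _ _) (hin' l k hkl.symm _ _) (hin' l k hkl.symm _ _)
  let f : Fin g → ℝ := fun k => D.left (e (k, s k))
  refine ⟨fun k => e (Tuple.sort f k, s (Tuple.sort f k)),
    fun k => e (Tuple.sort f k, !s (Tuple.sort f k)), fun k => hs _, fun k l hkl => ?_⟩
  have hmono : f (Tuple.sort f k) ≤ f (Tuple.sort f l) := Tuple.monotone_sort f hkl.le
  refine (hsep _ _ ((Tuple.sort f).injective.ne hkl.ne)).resolve_right fun h => ?_
  have h1 := hs (Tuple.sort f l)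
  simp only [f] at hmono
  linarith [h1.1, h1.2.1, h1.2.2]

/-- A numbering of the arcs in which the left ends increase is the one used by the period
vector. -/
lemma sort_left_eq_of_strictMono (D : ArcDiagram n) {f : Fin n → Fin n}
    (hf : StrictMono fun m => D.left (f m)) (m : Fin n) : Tuple.sort D.left m = f m := by
  have hinj : Function.Injective f := fun x y h => hf.injective (congrArg D.left h)
  have hσ : Equiv.ofBijective f (Finite.injective_iff_bijective.1 hinj) = Tuple.sort D.left := by
    refine Tuple.eq_sort_iff.2 ⟨hf.monotone, fun i j hij h => ?_⟩
    exact absurd h (hf hij).ne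
  exact (congrArg (fun τ : Equiv.Perm (Fin n) => τ m) hσ).symm

/-- In the order of the left ends the intersection matrix of a caravan is block diagonal with blocks
`(0 1; -1 0)`; `pairIndex` turns this into the negative of Mathlib's `Matrix.J`. -/
lemma IsCaravan.intersectionMatrix_sort {g : ℕ} {D : ArcDiagram (2 * g)} (hD : D.IsCaravan) :
    D.intersectionMatrix.submatrix (Tuple.sort D.left ∘ pairIndex g)
      (Tuple.sort D.left ∘ pairIndex g) = -Matrix.J (Fin g) ℤ := by
  obtain ⟨a, b, hab, hlt⟩ := hD.exists_ordered_pairs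
  let f : Fin (2 * g) → Fin (2 * g) := fun m => Sum.elim a b ((pairIndex g).symm m)
  have hf : StrictMono fun m => D.left (f m) := by
    intro m m' hm
    obtain ⟨x, rfl⟩ := (pairIndex g).surjective m
    obtain ⟨y, rfl⟩ := (pairIndex g).surjective m'
    simp only [f, Equiv.symm_apply_apply]
    rcases x with k | k <;> rcases y with l | l <;>
      simp only [pairIndex, Equiv.coe_fn_mk, Fin.mk_lt_mk, Sum.elim_inl, Sum.elim_inr] at hm ⊢ <;>
    · have hkl : k < l ∨ k = l := by
        rw [Fin.lt_def, Fin.ext_iff]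
        omega
      rcases hkl with hkl | rfl
      · linarith [hlt k l hkl, (hab k).1, (hab k).2.1, (hab k).2.2, (hab l).1]
      · first
          | exact (hab k).1
          | exact absurd hm (by omega)
  have ha : ∀ k, Tuple.sort D.left (pairIndex g (Sum.inl k)) = a k := fun k => by
    rw [D.sort_left_eq_of_strictMono hf]
    simp [f]
  have hb : ∀ k, Tuple.sort D.left (pairIndex g (Sum.inr k)) = b k := fun k => by
    rw [D.sort_left_eq_of_strictMono hf]
    simp [f]
  have hpair : ∀ k, D.intersectionMatrix (a k) (b k) = 1 := fun k =>
    D.intersectionMatrix_eq_one (hab k).1 (hab k).2.1 (hab k).2.2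
  have hzero : ∀ k l, k < l → ∀ i ∈ ({a k, b k} : Set (Fin (2 * g))),
      ∀ j ∈ ({a l, b l} : Set (Fin (2 * g))), D.intersectionMatrix i j = 0 := by
    intro k l hkl i hi j hj
    apply D.intersectionMatrix_eq_zero
    have h1 := hlt k l hkl
    have h2 := (hab k).2.2
    have h3 := (hab l).1
    rcases hi with rfl | rfl <;> rcases hj with rfl | rfl <;> linarith
  have hzero' : ∀ k l, k ≠ l → ∀ i ∈ ({a k, b k} : Set (Fin (2 * g))),
      ∀ j ∈ ({a l, b l} : Set (Fin (2 * g))), D.intersectionMatrix i j = 0 := by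
    intro k l hkl i hi j hj
    rcases lt_or_gt_of_ne hkl with h | h
    · exact hzero k l h i hi j hj
    · rw [D.intersectionMatrix_skew, hzero l k h j hj i hi, neg_zero]
  ext x y
  rcases x with k | k <;> rcases y with l | l <;>
    simp only [submatrix_apply, Function.comp_apply, ha, hb, Matrix.J, neg_apply,
      fromBlocks_apply₁₁, fromBlocks_apply₁₂, fromBlocks_apply₂₁, fromBlocks_apply₂₂,
      Matrix.zero_apply, one_apply, neg_neg, neg_zero] <;>
    rcases eq_or_ne k l with rfl | hkl
  · exact D.intersectionMatrix_self _
  · exact hzero' k l hkl _ (by simp) _ (by simp)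
  · simpa using hpair k
  · simpa [hkl] using hzero' k l hkl _ (by simp) _ (by simp)
  · rw [D.intersectionMatrix_skew, hpair]
    simp
  · simpa [hkl] using hzero' k l hkl _ (by simp) _ (by simp)
  · exact D.intersectionMatrix_self _
  · exact hzero' k l hkl _ (by simp) _ (by simp)

end ArcDiagram

/-! ### Periods of caravans -/

open ArcDiagram in
theorem mainTheorem3 (g : ℕ) (x₁ : SimpleRealNormalizedDifferential.{u} g)
    (x₂ : SimpleRealNormalizedDifferential.{v} g) (D₁ D₂ : ArcDiagram (2 * g))
    (hx₁ : x₁.HasArcDiagram D₁) (hx₂ : x₂.HasArcDiagram D₂)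
    (hD₁ : D₁.IsCaravan) (hD₂ : D₂.IsCaravan) (hD : D₂.ObtainedFrom D₁) :
    ∃ M ∈ integerSymplecticGroup g,
      D₁.periodVector = (M.map (Int.cast : ℤ → ℝ)).mulVec D₂.periodVector := by
  obtain ⟨σ, hσ⟩ := hD
  obtain ⟨A, hlen, hΩ⟩ := IsIntegralChange.of_reflTransGen hσ
  have hJ₁ := hD₁.intersectionMatrix_sort
  have hJ₂ := hD₂.intersectionMatrix_sort
  set τ₁ : Equiv.Perm (Fin (2 * g)) := Tuple.sort D₁.left with hτ₁
  set τ₂ : Equiv.Perm (Fin (2 * g)) := Tuple.sort D₂.left with hτ₂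
  -- The matrix `A` in the numberings of the arcs by their left ends.
  let B : Matrix (Fin (2 * g)) (Fin (2 * g)) ℤ := A.submatrix (σ.symm ∘ τ₂) τ₁
  have hP : D₂.periodVector = (B.map (Int.cast : ℤ → ℝ)) *ᵥ D₁.periodVector := by
    ext k
    have h := congrFun hlen (σ.symm (τ₂ k))
    have h' : (D₂.renumber σ).length (σ.symm (τ₂ k)) = D₂.periodVector k := by
      simp [ArcDiagram.length, ArcDiagram.left, ArcDiagram.right, renumber, periodVector, hτ₂]
    rw [← h', h]
    simp only [mulVec, dotProduct, B, map_apply, submatrix_apply, Function.comp_apply]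
    exact (Equiv.sum_comp τ₁ fun m => (A (σ.symm (τ₂ k)) m : ℝ) * D₁.length m).symm
  have hΩ₂ : D₂.intersectionMatrix.submatrix τ₂ τ₂ =
      B * D₁.intersectionMatrix.submatrix τ₁ τ₁ * Bᵀ := by
    have h : D₂.intersectionMatrix.submatrix τ₂ τ₂ =
        (D₂.renumber σ).intersectionMatrix.submatrix (σ.symm ∘ τ₂) (σ.symm ∘ τ₂) := by
      ext k l
      simp [intersectionMatrix, ArcDiagram.indicator, renumber]
    rw [h, hΩ, transpose_submatrix, submatrix_mul_equiv, submatrix_mul_equiv]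
  have hB : B.submatrix (pairIndex g) (pairIndex g) ∈ Matrix.symplecticGroup (Fin g) ℤ := by
    have h := congrArg (fun N => N.submatrix (pairIndex g) (pairIndex g)) hΩ₂
    simp only [← submatrix_mul_equiv _ _ (pairIndex g) (pairIndex g) (pairIndex g),
      submatrix_submatrix, ← transpose_submatrix] at h
    rw [hJ₁, hJ₂, Matrix.mul_neg, Matrix.neg_mul, neg_inj] at h
    exact SymplecticGroup.mem_iff.2 h.symm
  let S : Matrix.symplecticGroup (Fin g) ℤ := ⟨_, hB⟩
  let N : Matrix (Fin g ⊕ Fin g) (Fin g ⊕ Fin g) ℤ := (S⁻¹).1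
  have hNB : N * B.submatrix (pairIndex g) (pairIndex g) = 1 :=
    congrArg Subtype.val (inv_mul_cancel S)
  have hMB : N.submatrix (pairIndex g).symm (pairIndex g).symm * B = 1 := by
    have h := congrArg (fun N => N.submatrix (pairIndex g).symm (pairIndex g).symm) hNB
    simpa [← submatrix_mul_equiv _ _ (pairIndex g).symm (pairIndex g).symm (pairIndex g).symm,
      submatrix_submatrix] using h
  refine ⟨N.submatrix (pairIndex g).symm (pairIndex g).symm, ?_, ?_⟩
  · simp only [integerSymplecticGroup, Set.mem_ofPred_eq, submatrix_submatrix,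
      Equiv.symm_comp_self, submatrix_id_id]
    exact (S⁻¹).2
  · have h := congrArg (fun L => L.map (Int.castRingHom ℝ)) hMB
    simp only [Matrix.map_mul] at h
    rw [hP, mulVec_mulVec]
    refine Eq.trans ?_ (congrArg (· *ᵥ D₁.periodVector) h).symm
    simp
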